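/- Let $\mathfrak X$ be a real normed space (not necessarily complete) with a Schauder basis $(e_n)_{n\in\mathbb N}$, that is, every $x\in\mathfrak X$ has a unique norm-convergent expansion $x=\sum_n e_n^*(x)e_n$, where the coordinate functionals $e_n^*$ are continuous. Put $\operatorname{supp}x=\{n: e_n^*(x)\neq0\}$. A block sequence is a sequence $U=(u_n)_{n\in\mathbb N}$ of nonzero finitely supported vectors with $\max\operatorname{supp}u_n<\min\operatorname{supp}u_{n+1}$ for all $n$; let $\mathcal B^\infty$ be the set of all block sequences and $\mathcal B_1^\infty$ the set of those in the closed unit ball of $\mathfrak X$, with the topology induced by the product of the norm topology. A block sequence $Y$ is a block subsequence of a block sequence $Z$ if every term of $Y$ lies in the (algebraic) linear span of the terms of $Z$; let $\mathcal B_1^\infty(Z)$ be the set of block subsequences of $Z$ in the closed unit ball. Let $k\ge2$, let $(\mathcal B_1^\infty(Z))^k_\perp$ be the set of all $k$-tuples in $(\mathcal B_1^\infty(Z))^k$ that are pairwise disjointly supported (for $i\ne j$, every term of the $i$-th sequence and every term of the $j$-th one have disjoint supports), and let $\Delta=(\delta_n)_{n\in\mathbb N}$ be a sequence of positive reals. For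 $\mathfrak F\subseteq(\mathcal B^\infty)^k$ let $\mathfrak F_\Delta$ be the set of all $(U_i)_{i<k}\in(\mathcal B^\infty)^k$ for which there is $(V_i)_{i<k}\in\mathfrak F$ such that, for every $i$, the $n$-th terms of $U_i$ and $V_i$ are at distance at most $\delta_n$ for all $n$; and let $\mathfrak F^\uparrow$ be the set of all $(U_i)_{i<k}\in(\mathcal B^\infty)^k$ for which there is $(V_i)_{i<k}\in\mathfrak F$ such that $V_i$ is a block subsequence of $U_i$ for every $i$. **Theorem 2 (Ramsey).** Let $k\ge2$ and let $\mathfrak F$ be an analytic subset of $(\mathcal B_1^\infty)^k$ (empty, or a continuous image of $\mathbb N^{\mathbb N}$). Then for every sequence $\Delta=(\delta_n)_n$ of positive reals there is a block sequence $Y\in\mathcal B^\infty$ such that either $$(\mathcal B_1^\infty(Y))^k_\perp\cap\mathfrak F=\emptyset\qquad\text{or}\qquad(\mathcal B_1^\infty(Y))^k\subseteq(\mathfrak F_\Delta)^\uparrow.$$ -/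

import Mathlib

namespace BlockRamsey

section Definitions

variable {X : Type*} [NormedAddCommGroup X] [NormedSpace ℝ X]

/-- The support of a vector with respect to a Schauder basis `e`. -/
def supp (e : SchauderBasis ℝ X) (x : X) : Set ℕ := {i | e.coord i x ≠ 0}

/-- The set of (infinite) block sequences of `X`: sequences of nonzero, finitely supported vectors
with `max supp (U n) < min supp (U (n + 1))` for all `n`. -/
def blockSeqs (e : SchauderBasis ℝ X) : Set (ℕ → X) :=
  {U | (∀ n, U n ≠ 0 ∧ (supp e (U n)).Finite) ∧
    ∀ n, ∀ i ∈ supp e (U n), ∀ j ∈ supp e (U (n + 1)), i < j}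

/-- The set of block sequences in the closed unit ball of `X`. -/
def unitBlockSeqs (e : SchauderBasis ℝ X) : Set (ℕ → X) :=
  {U | U ∈ blockSeqs e ∧ ∀ n, ‖U n‖ ≤ 1}

/-- `Y` is a block subsequence of `Z`: both are block sequences and every term of `Y` is in the
(algebraic) linear span of the terms of `Z`. -/
def IsBlockSubseq (e : SchauderBasis ℝ X) (Y Z : ℕ → X) : Prop :=
  Y ∈ blockSeqs e ∧ Z ∈ blockSeqs e ∧ ∀ n, Y n ∈ Submodule.span ℝ (Set.range Z)

/-- The set of block subsequences of `Z` in the closed unit ball of `X`. -/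
def unitBlockSubseqs (e : SchauderBasis ℝ X) (Z : ℕ → X) : Set (ℕ → X) :=
  {Y | Y ∈ unitBlockSeqs e ∧ IsBlockSubseq e Y Z}

/-- Two sequences of vectors are disjointly supported. -/
def DisjointlySupported (e : SchauderBasis ℝ X) (U V : ℕ → X) : Prop :=
  ∀ m n, supp e (U m) ∩ supp e (V n) = ∅

/-- The set of all `k`-tuples of block subsequences of `Z` in the closed unit ball. -/
def unitTuples (e : SchauderBasis ℝ X) (k : ℕ) (Z : ℕ → X) : Set (Fin k → ℕ → X) :=
  {U | ∀ i, U i ∈ unitBlockSubseqs e Z}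

/-- The set of all `k`-tuples of pairwise disjointly supported block subsequences of `Z` in the
closed unit ball. -/
def disjointUnitTuples (e : SchauderBasis ℝ X) (k : ℕ) (Z : ℕ → X) : Set (Fin k → ℕ → X) :=
  {U | (∀ i, U i ∈ unitBlockSubseqs e Z) ∧ ∀ i j, i ≠ j → DisjointlySupported e (U i) (U j)}

/-- `U` and `V` are `Δ`-near. -/
def IsNear (Δ : ℕ → ℝ) (U V : ℕ → X) : Prop :=
  ∀ n, ‖U n - V n‖ ≤ Δ n

/-- The `Δ`-expansion of a family of `k`-tuples of block sequences. -/
def expansion (e : SchauderBasis ℝ X) {k : ℕ} (Δ : ℕ → ℝ) (F : Set (Fin k → ℕ → X)) :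
    Set (Fin k → ℕ → X) :=
  {U | (∀ i, U i ∈ blockSeqs e) ∧ ∃ V ∈ F, ∀ i, IsNear Δ (U i) (V i)}

/-- The upward closure of a family of `k`-tuples of block sequences. -/
def upClosure (e : SchauderBasis ℝ X) {k : ℕ} (F : Set (Fin k → ℕ → X)) :
    Set (Fin k → ℕ → X) :=
  {U | (∀ i, U i ∈ blockSeqs e) ∧ ∃ V ∈ F, ∀ i, IsBlockSubseq e (V i) (U i)}

end Definitions

end BlockRamsey

open Filter Topology

namespace BlockRamsey

variable {X : Type*} [NormedAddCommGroup X] [NormedSpace ℝ X]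

/-! ### Coordinates and supports -/

/-! Let `f` be continuous with range the given family. A position is a tuple `s` of finitely
supported vectors together with a word `σ`, the beginning of a code. It is viable when every rich
subspace allows `s` to be extended to a disjoint block tuple close to the image of the cylinder of
`σ`. If the empty position fails this with error `0`, the failing subspace gives the first
alternative. Otherwise a fusion produces `Y` in which all questions about positions in suitable
finite nets are already decided (`exists_decides`).

The heart is `Viable.reaches`. Viability concerns tuples inside one common subspace, yet it yields
extensions whose components lie in subspaces `V i` prescribed independently. Suppose a viable
position reaches no such extension, and call such positions bad. If every rich subspace contained a
vector turning a bad position into a good one by extending component `i`, that vector could be taken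
in `V i` and the position would be good. So a fusion gives a sequence `z` whose span contains no
such vectors. A disjoint tuple `W` extending the position by vectors of the span of `z` uses each
block `z n` in at most one term, so all its truncations stay bad. But `W` is close to the image of a
longer cylinder, so a long truncation is viable for the longer word and is its own target: a
contradiction.

Iterating (`exists_near_of_reaches`) turns the words into an infinite code `α` and the positions
into block sequences in the `V i` close to `f α`. With `V i` the span of `U i` this is the second
alternative. All approximation errors are kept below `Δ` by a geometric budget. -/

theorem mem_supp {e : SchauderBasis ℝ X} {x : X} {i : ℕ} : i ∈ supp e x ↔ e.coord i x ≠ 0 :=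
  Iff.rfl

theorem eq_of_coord (e : SchauderBasis ℝ X) {x y : X} (h : ∀ n, e.coord n x = e.coord n y) :
    x = y := by
  refine tendsto_nhds_unique (e.tendsto_proj x) ?_
  have : (fun n => e.proj n x) = fun n => e.proj n y := by
    funext n
    simp [h]
  rw [this]
  exact e.tendsto_proj y

theorem coord_proj (e : SchauderBasis ℝ X) (i n : ℕ) (x : X) :
    e.coord i (e.proj n x) = if i < n then e.coord i x else 0 := by
  simp [e.ortho, Pi.single_apply]

theorem supp_nonempty (e : SchauderBasis ℝ X) {x : X} (hx : x ≠ 0) : (supp e x).Nonempty := by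
  by_contra h
  refine hx (eq_of_coord e fun n => ?_)
  by_contra hn
  exact h ⟨n, by simpa [mem_supp] using hn⟩

theorem ne_zero_of_mem_supp {e : SchauderBasis ℝ X} {x : X} {i : ℕ} (h : i ∈ supp e x) :
    x ≠ 0 := by
  rintro rfl
  exact h (map_zero _)

theorem supp_proj (e : SchauderBasis ℝ X) (n : ℕ) (x : X) :
    supp e (e.proj n x) = supp e x ∩ Set.Iio n := by
  ext i
  simp only [mem_supp, coord_proj, Set.mem_inter_iff, Set.mem_Iio]
  split_ifs with h <;> simp [h]

theorem proj_eq_self (e : SchauderBasis ℝ X) {n : ℕ} {x : X} (h : supp e x ⊆ Set.Iio n) :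
    e.proj n x = x := by
  refine eq_of_coord e fun i => ?_
  rw [coord_proj]
  split_ifs with hi
  · rfl
  · by_contra h0
    exact hi (h (Ne.symm h0))

theorem proj_eq_zero (e : SchauderBasis ℝ X) {n : ℕ} {x : X} (h : ∀ i < n, e.coord i x = 0) :
    e.proj n x = 0 := by
  refine eq_of_coord e fun i => ?_
  rw [coord_proj]
  split_ifs with hi
  · simp [h i hi]
  · simp

/-! ### Block sequences and disjoint tuples -/

theorem supp_lt_of_lt {e : SchauderBasis ℝ X} {U : ℕ → X} (hU : U ∈ blockSeqs e) {j j' : ℕ}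
    (hj : j < j') : ∀ i ∈ supp e (U j), ∀ i' ∈ supp e (U j'), i < i' := by
  induction j', hj using Nat.le_induction with
  | base => exact hU.2 j
  | succ m hm ih =>
    intro i hi i' hi'
    obtain ⟨l, hl⟩ := supp_nonempty e (hU.1 m).1
    exact (ih i hi l hl).trans (hU.2 m l hl i' hi')

theorem le_of_mem_supp {e : SchauderBasis ℝ X} {U : ℕ → X} (hU : U ∈ blockSeqs e) {j : ℕ} :
    ∀ i ∈ supp e (U j), j ≤ i := by
  induction j with
  | zero => simp
  | succ j ih =>
    intro i hi
    obtain ⟨l, hl⟩ := supp_nonempty e (hU.1 j).1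
    exact (ih l hl).trans_lt (hU.2 j l hl i hi)

theorem blockSeqs_congr {e : SchauderBasis ℝ X} {U V : ℕ → X}
    (h : ∀ n, supp e (U n) = supp e (V n)) (hU : U ∈ blockSeqs e) : V ∈ blockSeqs e := by
  refine ⟨fun n => ⟨?_, h n ▸ (hU.1 n).2⟩, fun n => ?_⟩
  · obtain ⟨i, hi⟩ := supp_nonempty e (hU.1 n).1
    exact ne_zero_of_mem_supp (h n ▸ hi)
  · rw [← h, ← h]
    exact hU.2 n

/-- Tuples of pairwise disjointly supported block sequences. -/
def disjointTuples (e : SchauderBasis ℝ X) (k : ℕ) : Set (Fin k → ℕ → X) :=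
  {U | (∀ i, U i ∈ blockSeqs e) ∧ ∀ i j, i ≠ j → DisjointlySupported e (U i) (U j)}

theorem disjointTuples_congr {e : SchauderBasis ℝ X} {k : ℕ} {U V : Fin k → ℕ → X}
    (h : ∀ i n, supp e (U i n) = supp e (V i n)) (hU : U ∈ disjointTuples e k) :
    V ∈ disjointTuples e k := by
  refine ⟨fun i => blockSeqs_congr (h i) (hU.1 i), fun i j hij m n => ?_⟩
  rw [← h, ← h]
  exact hU.2 i j hij m n

theorem disjointTuples_unique {e : SchauderBasis ℝ X} {k : ℕ} {U : Fin k → ℕ → X}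
    (hU : U ∈ disjointTuples e k) {i i' : Fin k} {j j' l : ℕ} (h : l ∈ supp e (U i j))
    (h' : l ∈ supp e (U i' j')) : i = i' ∧ j = j' := by
  have hi : i = i' := by
    by_contra hne
    have := hU.2 i i' hne j j'
    exact (this ▸ ⟨h, h'⟩ : l ∈ (∅ : Set ℕ))
  subst hi
  refine ⟨rfl, ?_⟩
  rcases lt_trichotomy j j' with hj | hj | hj
  · exact absurd (supp_lt_of_lt (hU.1 i) hj l h l h') (lt_irrefl l)
  · exact hj
  · exact absurd (supp_lt_of_lt (hU.1 i) hj l h' l h) (lt_irrefl l)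

/-! ### Tails of subspaces -/

/-- The vectors of `S` whose first `N` coordinates vanish. -/
noncomputable def past (e : SchauderBasis ℝ X) (S : Submodule ℝ X) (N : ℕ) : Submodule ℝ X :=
  S ⊓ ⨅ i ∈ Finset.range N, LinearMap.ker (e.coord i).toLinearMap

theorem mem_past {e : SchauderBasis ℝ X} {S : Submodule ℝ X} {N : ℕ} {x : X} :
    x ∈ past e S N ↔ x ∈ S ∧ ∀ i < N, e.coord i x = 0 := by
  simp [past, Submodule.mem_iInf]

theorem past_le (e : SchauderBasis ℝ X) (S : Submodule ℝ X) (N : ℕ) : past e S N ≤ S :=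
  inf_le_left

theorem past_mono (e : SchauderBasis ℝ X) {S S' : Submodule ℝ X} {N N' : ℕ} (hS : S' ≤ S)
    (hN : N ≤ N') : past e S' N' ≤ past e S N := fun _ hx =>
  mem_past.2 ⟨hS (mem_past.1 hx).1, fun i hi => (mem_past.1 hx).2 i (hi.trans_le hN)⟩

/-- A subspace of finitely supported vectors with nonzero vectors arbitrarily far out. -/
def Rich (e : SchauderBasis ℝ X) (S : Submodule ℝ X) : Prop :=
  (∀ x ∈ S, (supp e x).Finite) ∧ ∀ N, ∃ x ∈ past e S N, x ≠ 0

theorem Rich.past {e : SchauderBasis ℝ X} {S : Submodule ℝ X} (hS : Rich e S) (N : ℕ) :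
    Rich e (past e S N) := by
  refine ⟨fun x hx => hS.1 x (past_le e S N hx), fun M => ?_⟩
  obtain ⟨x, hx, h0⟩ := hS.2 (max M N)
  refine ⟨x, mem_past.2 ⟨past_mono e le_rfl (le_max_right _ _) hx, fun i hi => ?_⟩, h0⟩
  exact (mem_past.1 hx).2 i (lt_max_of_lt_left hi)

theorem finite_supp_of_mem_span {e : SchauderBasis ℝ X} {s : Set X}
    (hs : ∀ x ∈ s, (supp e x).Finite) : ∀ x ∈ Submodule.span ℝ s, (supp e x).Finite := by
  intro x hx
  induction hx using Submodule.span_induction with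
  | mem x h => exact hs x h
  | zero => simp [supp]
  | add x y _ _ hx hy =>
    refine (hx.union hy).subset fun i hi => ?_
    by_contra h
    simp only [Set.mem_union, mem_supp, not_or, not_not] at h
    exact hi (by simp [h.1, h.2])
  | smul c x _ hx =>
    refine hx.subset fun i hi h => hi ?_
    simp [h]

/-! ### Sequences carried by successive intervals -/

/-- `z n` is a nonzero vector supported by the interval `[a n, a (n + 1))`. -/
structure Carried (e : SchauderBasis ℝ X) (a : ℕ → ℕ) (z : ℕ → X) : Prop where
  strictMono : StrictMono a
  ne_zero : ∀ n, z n ≠ 0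
  supp_subset : ∀ n, supp e (z n) ⊆ Set.Ico (a n) (a (n + 1))

namespace Carried

variable {e : SchauderBasis ℝ X} {a : ℕ → ℕ} {z : ℕ → X}

theorem finite (h : Carried e a z) (n : ℕ) : (supp e (z n)).Finite :=
  (Set.finite_Ico _ _).subset (h.supp_subset n)

theorem mem_blockSeqs (h : Carried e a z) : z ∈ blockSeqs e :=
  ⟨fun n => ⟨h.ne_zero n, h.finite n⟩, fun n _ hi _ hj =>
    (h.supp_subset n hi).2.trans_le (h.supp_subset (n + 1) hj).1⟩

theorem proj_of_lt (h : Carried e a z) {m n : ℕ} (hmn : m < n) : e.proj (a n) (z m) = z m :=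
  proj_eq_self e fun _ hi =>
    (h.supp_subset m hi).2.trans_le (h.strictMono.monotone (Nat.succ_le_of_lt hmn))

theorem proj_of_le (h : Carried e a z) {m n : ℕ} (hmn : n ≤ m) : e.proj (a n) (z m) = 0 := by
  refine proj_eq_zero e fun i hi => ?_
  by_contra h0
  exact absurd (hi.trans_le ((h.strictMono.monotone hmn).trans (h.supp_subset m h0).1))
    (lt_irrefl i)

theorem proj_mem_span (h : Carried e a z) (n : ℕ) {x : X}
    (hx : x ∈ Submodule.span ℝ (Set.range z)) :
    e.proj (a n) x ∈ Submodule.span ℝ (Set.range z) := by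
  have : Submodule.span ℝ (Set.range z) ≤
      (Submodule.span ℝ (Set.range z)).comap (e.proj (a n)).toLinearMap := by
    rw [Submodule.span_le]
    rintro _ ⟨m, rfl⟩
    change e.proj (a n) (z m) ∈ Submodule.span ℝ (Set.range z)
    rcases lt_or_ge m n with hm | hm
    · rw [h.proj_of_lt hm]
      exact Submodule.subset_span ⟨m, rfl⟩
    · rw [h.proj_of_le hm]
      exact Submodule.zero_mem _
  exact this hx

theorem proj_succ_sub (h : Carried e a z) (n : ℕ) {x : X}
    (hx : x ∈ Submodule.span ℝ (Set.range z)) :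
    ∃ c : ℝ, e.proj (a (n + 1)) x - e.proj (a n) x = c • z n := by
  have : Submodule.span ℝ (Set.range z) ≤
      (Submodule.span ℝ {z n}).comap (e.proj (a (n + 1)) - e.proj (a n)).toLinearMap := by
    rw [Submodule.span_le]
    rintro _ ⟨m, rfl⟩
    change e.proj (a (n + 1)) (z m) - e.proj (a n) (z m) ∈ Submodule.span ℝ {z n}
    rcases lt_trichotomy m n with hm | rfl | hm
    · rw [h.proj_of_lt hm, h.proj_of_lt (hm.trans n.lt_succ_self), sub_self]
      exact Submodule.zero_mem _
    · rw [h.proj_of_lt m.lt_succ_self, h.proj_of_le le_rfl, sub_zero]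
      exact Submodule.mem_span_singleton_self _
    · rw [h.proj_of_le hm, h.proj_of_le hm.le, sub_self]
      exact Submodule.zero_mem _
  obtain ⟨c, hc⟩ := Submodule.mem_span_singleton.1 (this hx)
  exact ⟨c, hc.symm⟩

theorem past_le_of_forall_mem (h : Carried e a z) (n : ℕ) {S : Submodule ℝ X}
    (hS : ∀ m, n ≤ m → z m ∈ S) : past e (Submodule.span ℝ (Set.range z)) (a n) ≤ S := by
  intro x hx
  have : Submodule.span ℝ (Set.range z) ≤
      S.comap (ContinuousLinearMap.id ℝ X - e.proj (a n)).toLinearMap := by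
    rw [Submodule.span_le]
    rintro _ ⟨m, rfl⟩
    change z m - e.proj (a n) (z m) ∈ S
    rcases lt_or_ge m n with hm | hm
    · rw [h.proj_of_lt hm, sub_self]
      exact Submodule.zero_mem _
    · rw [h.proj_of_le hm, sub_zero]
      exact hS m hm
  have h1 : x - e.proj (a n) x ∈ S := this (mem_past.1 hx).1
  rwa [proj_eq_zero e (mem_past.1 hx).2, sub_zero] at h1

theorem mem_past (h : Carried e a z) (n : ℕ) :
    z n ∈ past e (Submodule.span ℝ (Set.range z)) (a n) := by
  refine BlockRamsey.mem_past.2 ⟨Submodule.subset_span ⟨n, rfl⟩, fun i hi => ?_⟩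
  by_contra h0
  exact absurd (hi.trans_le (h.supp_subset n h0).1) (lt_irrefl i)

theorem rich_span (h : Carried e a z) : Rich e (Submodule.span ℝ (Set.range z)) := by
  refine ⟨finite_supp_of_mem_span ?_, fun N => ⟨z N, ?_, h.ne_zero N⟩⟩
  · rintro _ ⟨n, rfl⟩
    exact h.finite n
  · exact past_mono e le_rfl (h.strictMono.le_apply) (h.mem_past N)

end Carried

theorem rich_span_of_mem_blockSeqs {e : SchauderBasis ℝ X} {U : ℕ → X} (hU : U ∈ blockSeqs e) :
    Rich e (Submodule.span ℝ (Set.range U)) := by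
  refine ⟨finite_supp_of_mem_span ?_, fun N => ⟨U N, ?_, (hU.1 N).1⟩⟩
  · rintro _ ⟨n, rfl⟩
    exact (hU.1 n).2
  · refine mem_past.2 ⟨Submodule.subset_span ⟨N, rfl⟩, fun i hi => ?_⟩
    by_contra h0
    exact absurd (le_of_mem_supp hU i h0) (by omega)

/-! ### Fusion -/

/-- By `hmono`, `P N` depends only on the part of a subspace beyond `N`. Along a decreasing chain of
subspaces, the one chosen at stage `n` satisfies `P (a n)` and contains `z m` for all `m ≥ n`, hence
it contains the tail of the final span past `a n`. -/
theorem exists_fusion (e : SchauderBasis ℝ X) (P : ℕ → Submodule ℝ X → Prop)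
    (hmono : ∀ N S S', past e S' N ≤ S → P N S → P N S') {S₀ : Submodule ℝ X}
    (hS₀ : Rich e S₀) {A : Set ℕ} (hA : ∀ n, ∃ m ∈ A, n < m) {M₀ : ℕ} (hM₀ : M₀ ∈ A)
    (hdense : ∀ N ∈ A, ∀ S ≤ S₀, Rich e S → ∃ S' ≤ S, Rich e S' ∧ P N S') :
    ∃ (a : ℕ → ℕ) (z : ℕ → X), Carried e a z ∧ a 0 = M₀ ∧ (∀ n, a n ∈ A) ∧
      Submodule.span ℝ (Set.range z) ≤ S₀ ∧ ∀ n, P (a n) (Submodule.span ℝ (Set.range z)) := by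
  let State := {p : Submodule ℝ X × ℕ // p.1 ≤ S₀ ∧ Rich e p.1 ∧ p.2 ∈ A}
  have step : ∀ p : State, ∃ (q : State) (x : X), q.1.1 ≤ p.1.1 ∧ P p.1.2 q.1.1 ∧
      x ∈ q.1.1 ∧ x ≠ 0 ∧ supp e x ⊆ Set.Ico p.1.2 q.1.2 ∧ p.1.2 < q.1.2 := by
    rintro ⟨⟨S, N⟩, hS, hR, hN⟩
    obtain ⟨S', hS', hR', hP⟩ := hdense N hN S hS hR
    obtain ⟨x, hx, hx0⟩ := hR'.2 N
    obtain ⟨b, hb⟩ := (hR'.1 x (past_le e _ _ hx)).bddAbove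
    obtain ⟨M, hM, hlt⟩ := hA (max N b)
    refine ⟨⟨⟨S', M⟩, hS'.trans hS, hR', hM⟩, x, hS', hP, past_le e _ _ hx, hx0, ?_,
      (le_max_left _ _).trans_lt hlt⟩
    intro i hi
    refine ⟨?_, ((hb hi).trans (le_max_right _ _)).trans_lt hlt⟩
    by_contra hlt'
    exact hi ((mem_past.1 hx).2 i (not_le.1 hlt'))
  choose g x hg hP hx hx0 hsupp hlt using step
  let p : ℕ → State := fun n => g^[n] ⟨⟨S₀, M₀⟩, le_rfl, hS₀, hM₀⟩
  have hp : ∀ n, p (n + 1) = g (p n) := fun n => Function.iterate_succ_apply' g n _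
  have hcar : Carried e (fun n => (p n).1.2) (fun n => x (p n)) := by
    refine ⟨strictMono_nat_of_lt_succ fun n => ?_, fun n => hx0 _, fun n => ?_⟩
    · rw [hp]
      exact hlt _
    · rw [hp]
      exact hsupp _
  have hanti : Antitone fun n => (p n).1.1 := antitone_nat_of_succ_le fun n => by
    rw [hp]
    exact hg _
  have hmem : ∀ n m, n ≤ m → x (p m) ∈ (g (p n)).1.1 := fun n m hnm => by
    rw [← hp]
    refine hanti (Nat.succ_le_succ hnm) ?_
    change _ ∈ (p (m + 1)).1.1
    rw [hp]
    exact hx _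
  refine ⟨_, _, hcar, rfl, fun n => (p n).2.2.2, ?_, fun n => ?_⟩
  · rw [Submodule.span_le]
    rintro _ ⟨n, rfl⟩
    exact (g (p n)).2.1 (hx _)
  · exact hmono _ _ _ (hcar.past_le_of_forall_mem n (hmem n)) (hP (p n))

/-- Finitely many hereditary and dense requirements can be met simultaneously. -/
theorem exists_forall_of_finite (e : SchauderBasis ℝ X) {ι : Type*} (P : ι → Submodule ℝ X → Prop)
    (hmono : ∀ c S S', S' ≤ S → P c S → P c S')
    {S : Submodule ℝ X} (hS : Rich e S)
    (hdense : ∀ c, ∀ S₁ ≤ S, Rich e S₁ → ∃ S' ≤ S₁, Rich e S' ∧ P c S')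
    {T : Set ι} (hT : T.Finite) :
    ∃ S' ≤ S, Rich e S' ∧ ∀ c ∈ T, P c S' := by
  induction T, hT using Set.Finite.induction_on with
  | empty => exact ⟨S, le_rfl, hS, by simp⟩
  | @insert c T _ _ ih =>
    obtain ⟨S₁, h₁, hR₁, hP₁⟩ := ih
    obtain ⟨S₂, h₂, hR₂, hP₂⟩ := hdense c S₁ h₁ hR₁
    refine ⟨S₂, h₂.trans h₁, hR₂, ?_⟩
    rintro d (rfl | hd)
    · exact hP₂
    · exact hmono d _ _ h₂ (hP₁ d hd)

section

/-! ### Perturbations of tuples and finite nets -/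

/-- `q` is obtained from `s` by a small change of the first `N` coordinates which does not affect
the supports. -/
structure Perturb (e : SchauderBasis ℝ X) (Δ : ℕ → ℝ) {k : ℕ} (η : ℝ) (N : ℕ)
    (s q : Fin k → ℕ → X) : Prop where
  supp_eq : ∀ i j, supp e (s i j) = supp e (q i j)
  coord_eq : ∀ i j n, N ≤ n → e.coord n (s i j) = e.coord n (q i j)
  norm_sub_le : ∀ i j, ‖s i j - q i j‖ ≤ η * Δ j

namespace Perturb

variable {e : SchauderBasis ℝ X} {Δ : ℕ → ℝ} {k : ℕ} {η : ℝ} {N : ℕ} {s q : Fin k → ℕ → X}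

theorem symm (h : Perturb e Δ η N s q) : Perturb e Δ η N q s :=
  ⟨fun i j => (h.supp_eq i j).symm, fun i j n hn => (h.coord_eq i j n hn).symm,
    fun i j => norm_sub_rev (q i j) (s i j) ▸ h.norm_sub_le i j⟩

/-- A perturbation of `s` induces one of every extension of `s`. -/
theorem extend (h : Perturb e Δ η N s q) {M : ℕ} (hM : N ≤ M) {U : Fin k → ℕ → X}
    (hU : ∀ i j, ∀ n < N, e.coord n (U i j - s i j) = 0) :
    Perturb e Δ η M U (fun i j => U i j + (q i j - s i j)) := by
  refine ⟨fun i j => ?_, fun i j n hn => ?_, fun i j => ?_⟩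
  · ext n
    rw [mem_supp, mem_supp, map_add, map_sub]
    rcases lt_or_ge n N with hn | hn
    · have h1 := hU i j n hn
      rw [map_sub, sub_eq_zero] at h1
      have h2 : n ∈ supp e (s i j) ↔ n ∈ supp e (q i j) := by rw [h.supp_eq]
      rw [mem_supp, mem_supp] at h2
      rw [h1, add_sub_cancel, h2]
    · rw [h.coord_eq i j n hn, sub_self, add_zero]
  · rw [map_add, map_sub, h.coord_eq i j n (hM.trans hn), sub_self, add_zero]
  · rw [sub_add_cancel_left, neg_sub]
    exact h.norm_sub_le i j

theorem add (h : Perturb e Δ η N s q) {d : Fin k → ℕ → X}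
    (hd : ∀ i j, ∀ n < N, e.coord n (d i j) = 0) : Perturb e Δ η N (s + d) (q + d) := by
  have := h.extend le_rfl (U := s + d) (by simpa using hd)
  convert this using 1
  ext i j
  simp only [Pi.add_apply]
  abel

end Perturb

theorem exists_pos_forall_lt_le (g : ℕ → ℝ) (hg : ∀ n, 0 < g n) (M : ℕ) :
    ∃ ε > 0, ∀ j < M, ε ≤ g j := by
  induction M with
  | zero => exact ⟨1, one_pos, by simp⟩
  | succ M ih =>
    obtain ⟨ε, hε, h⟩ := ih
    refine ⟨min ε (g M), lt_min hε (hg M), fun j hj => ?_⟩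
    rcases Nat.lt_succ_iff_lt_or_eq.1 hj with hj | rfl
    · exact (min_le_left _ _).trans (h j hj)
    · exact min_le_right _ _

/-- Truncations live in a finite-dimensional space: they lie in the continuous image of a compact
box of coordinates, so completeness plays no role. -/
theorem totallyBounded_truncations (e : SchauderBasis ℝ X) {ι : Type*} [Fintype ι] (ρ : ι → ℝ)
    (M : ℕ) :
    TotallyBounded {s : ι → X | ∃ U : ι → X, (∀ p, ‖U p‖ ≤ ρ p) ∧ ∀ p, s p = e.proj M (U p)} := by
  let Φ : (ι → Fin M → ℝ) → ι → X := fun c p => ∑ i, c p i • e i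
  have hΦ : Continuous Φ := by fun_prop
  have hK : IsCompact (Set.univ.pi fun p : ι => Set.univ.pi fun i : Fin M =>
      Set.Icc (-(‖e.coord i‖ * ρ p)) (‖e.coord i‖ * ρ p)) :=
    isCompact_univ_pi fun p => isCompact_univ_pi fun i => isCompact_Icc
  refine (hK.image hΦ).totallyBounded.subset ?_
  rintro s ⟨U, hU, hs⟩
  refine ⟨fun p i => e.coord i (U p), fun p _ i _ => ?_, ?_⟩
  · refine abs_le.1 ?_
    rw [← Real.norm_eq_abs]
    exact (e.coord i).le_of_opNorm_le_of_le le_rfl (hU p)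
  · funext p
    rw [hs, SchauderBasis.proj_apply]
    exact Fin.sum_univ_eq_sum_range (fun i => e.coord i (U p) • e i) M

/-- Truncations are sorted by their finitely many support patterns and a net is taken inside each
pattern, so that approximation preserves block structure and disjointness. The bound `1 + Δ j` is
what a tuple within `Δ` of the unit ball satisfies. -/
theorem exists_finite_net (e : SchauderBasis ℝ X) {Δ : ℕ → ℝ} (hΔ : ∀ n, 0 < Δ n) (k M : ℕ)
    {η : ℝ} (hη : 0 < η) :
    ∃ Q : Set (Fin k → ℕ → X), Q.Finite ∧ ∀ U ∈ disjointTuples e k, (∀ i j, ‖U i j‖ ≤ 1 + Δ j) →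
      ∃ q ∈ Q, Perturb e Δ η M (fun i j => e.proj M (U i j)) q := by
  -- The `j`-th term of a block sequence has support in `[j, ∞)`, so only the terms `j < M` survive
  -- truncation and a single `ε` suffices.
  obtain ⟨ε, hε, hεΔ⟩ := exists_pos_forall_lt_le (fun j => η * Δ j) (fun j => mul_pos hη (hΔ j)) M
  let K : Set (Fin k × Fin M → X) := {s | ∃ U : Fin k × Fin M → X,
    (∀ p : Fin k × Fin M, ‖U p‖ ≤ 1 + Δ p.2) ∧ ∀ p, s p = e.proj M (U p)}
  have hK : TotallyBounded K := totallyBounded_truncations e (fun p : Fin k × Fin M => 1 + Δ p.2) M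
  let c : (Fin k × Fin M → X) → Fin k × Fin M → Set (Fin M) :=
    fun s p => {i | e.coord i (s p) ≠ 0}
  have hnet : ∀ γ, ∃ t ⊆ K ∩ {s | c s = γ}, t.Finite ∧
      K ∩ {s | c s = γ} ⊆ ⋃ y ∈ t, Metric.ball y ε := fun γ =>
    Metric.finite_approx_of_totallyBounded (hK.subset Set.inter_subset_left) ε hε
  choose t htK htf ht using hnet
  let E : (Fin k × Fin M → X) → Fin k → ℕ → X :=
    fun s i j => if h : j < M then s (i, ⟨j, h⟩) else 0
  refine ⟨E '' ⋃ γ, t γ, (Set.finite_iUnion htf).image E, fun U hU hb => ?_⟩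
  let s : Fin k × Fin M → X := fun p => e.proj M (U p.1 p.2)
  have hs : s ∈ K := ⟨fun p => U p.1 p.2, fun p => hb _ _, fun p => rfl⟩
  obtain ⟨y, hy, hsy⟩ := Set.mem_iUnion₂.1 (ht (c s) ⟨hs, rfl⟩)
  refine ⟨E y, ⟨y, Set.mem_iUnion.2 ⟨_, hy⟩, rfl⟩, ?_⟩
  obtain ⟨⟨U', -, hU'⟩, hcol⟩ := htK _ hy
  have hzero : ∀ i j, M ≤ j → e.proj M (U i j) = 0 := fun i j hj => by
    refine proj_eq_zero e fun n hn => ?_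
    by_contra h0
    exact absurd (le_of_mem_supp (hU.1 i) n h0) (by omega)
  have hcoord : ∀ i j n, M ≤ n → e.coord n (E y i j) = 0 := fun i j n hn => by
    simp only [E]
    split_ifs with hj
    · rw [hU', coord_proj, if_neg (not_lt.2 hn)]
    · exact map_zero _
  refine ⟨fun i j => ?_, fun i j n hn => ?_, fun i j => ?_⟩
  · ext n
    rcases lt_or_ge n M with hn | hn
    · rcases lt_or_ge j M with hj | hj
      · have h1 : (⟨n, hn⟩ : Fin M) ∈ c y (i, ⟨j, hj⟩) ↔ (⟨n, hn⟩ : Fin M) ∈ c s (i, ⟨j, hj⟩) := by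
          rw [show c y = c s from hcol]
        simpa [c, mem_supp, E, hj, s, -SchauderBasis.proj_apply] using h1.symm
      · simp only [hzero i j hj, E, not_lt.2 hj, dite_false]
    · rw [mem_supp, mem_supp, hcoord i j n hn, coord_proj, if_neg (not_lt.2 hn)]
  · rw [hcoord i j n hn, coord_proj, if_neg (not_lt.2 hn)]
  · rcases lt_or_ge j M with hj | hj
    · have h1 : dist (s (i, ⟨j, hj⟩)) (y (i, ⟨j, hj⟩)) ≤ ε :=
        (dist_le_pi_dist s y _).trans (Metric.mem_ball.1 hsy).le
      rw [dist_eq_norm] at h1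
      simpa [E, hj, s, -SchauderBasis.proj_apply] using h1.trans (hεΔ j hj)
    · simp only [hzero i j hj, E, not_lt.2 hj, dite_false, sub_zero, norm_zero]
      exact (mul_pos hη (hΔ j)).le

/-- The tuple whose only nonzero term is `x`, at place `j` of the component `i`. -/
def site {k : ℕ} (i : Fin k) (j : ℕ) (x : X) : Fin k → ℕ → X := Pi.single i (Pi.single j x)

theorem site_mem {k : ℕ} {i i' : Fin k} {j j' : ℕ} {x : X} {S : Submodule ℝ X}
    (hx : i' = i → j' = j → x ∈ S) : site i j x i' j' ∈ S := by
  unfold site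
  by_cases hi : i' = i
  · subst hi
    by_cases hj : j' = j
    · subst hj
      simpa using hx rfl rfl
    · simp [Pi.single_eq_of_ne hj]
  · simp [Pi.single_eq_of_ne hi]

/-! ### Positions -/

/-- The image under `f` of the set of all sequences with initial segment `σ`. -/
def cylinderImage {α : Type*} (f : (ℕ → ℕ) → α) (σ : List ℕ) : Set α :=
  f '' {β | (List.range σ.length).map β = σ}

theorem mem_cylinderImage_append {α : Type*} {f : (ℕ → ℕ) → α} {σ : List ℕ} {u : α}
    (hu : u ∈ cylinderImage f σ) : ∃ m, u ∈ cylinderImage f (σ ++ [m]) := by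
  obtain ⟨β, hβ, rfl⟩ := hu
  refine ⟨β σ.length, β, ?_, rfl⟩
  simp only [Set.mem_ofPred_eq] at hβ ⊢
  simp [List.range_succ, hβ]

section Positions

variable (e : SchauderBasis ℝ X) (Δ : ℕ → ℝ) {k : ℕ} (f : (ℕ → ℕ) → Fin k → ℕ → X)

/-- Up to an error `b * Δ`, some element of the family coded by `σ` extends `s` by vectors of
`S` supported beyond `N`. -/
def Meets (b : ℝ) (S : Submodule ℝ X) (s : Fin k → ℕ → X) (σ : List ℕ) (N : ℕ) : Prop :=
  ∃ U ∈ cylinderImage f σ, ∃ W ∈ disjointTuples e k,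
    (∀ i j, W i j - s i j ∈ past e S N) ∧ ∀ i j, ‖W i j - U i j‖ ≤ b * Δ j

/-- The family coded by `σ` is met inside every rich subspace of `S`. -/
def Viable (b : ℝ) (S : Submodule ℝ X) (s : Fin k → ℕ → X) (σ : List ℕ) (N : ℕ) : Prop :=
  ∀ S' ≤ S, Rich e S' → Meets e Δ f b S' s σ N

/-- Inside any given rich subspaces of `S`, one for each index, `s` has a finite extension which is
viable for a one-step prolongation of `σ`. -/
def Reaches (b : ℝ) (S : Submodule ℝ X) (s : Fin k → ℕ → X) (σ : List ℕ) (N : ℕ) : Prop :=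
  ∀ V : Fin k → Submodule ℝ X, (∀ i, V i ≤ S ∧ Rich e (V i)) →
    ∃ (s' : Fin k → ℕ → X) (m M : ℕ), N ≤ M ∧ (∀ i j, s' i j - s i j ∈ past e (V i) N) ∧
      (∀ i j, supp e (s' i j) ⊆ Set.Iio M) ∧ (∀ i, s' i σ.length ≠ 0) ∧
      Viable e Δ f b S s' (σ ++ [m]) M

end Positions

variable {e : SchauderBasis ℝ X} {Δ : ℕ → ℝ} {k : ℕ} {f : (ℕ → ℕ) → Fin k → ℕ → X}
  {b b' η : ℝ} {S S' : Submodule ℝ X} {s q : Fin k → ℕ → X} {σ : List ℕ} {N N' : ℕ}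

/-! ### Monotonicity and perturbation of positions -/

theorem Meets.mono (hΔ : ∀ n, 0 < Δ n) (h : Meets e Δ f b S s σ N) (hb : b ≤ b')
    (hS : past e S N ≤ S') : Meets e Δ f b' S' s σ N := by
  obtain ⟨U, hU, W, hW, h1, h2⟩ := h
  refine ⟨U, hU, W, hW, fun i j => mem_past.2 ⟨hS (h1 i j), (mem_past.1 (h1 i j)).2⟩,
    fun i j => (h2 i j).trans ?_⟩
  exact mul_le_mul_of_nonneg_right hb (hΔ j).le

/-- The witness `W` moves along to `W + (q - s)`: it agrees with `s` below `N`, where supports are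
preserved, and is unchanged from `N` on. -/
theorem Meets.perturb (h : Meets e Δ f b S s σ N) (hp : Perturb e Δ η N s q) :
    Meets e Δ f (b + η) S q σ N := by
  obtain ⟨U, hU, W, hW, h1, h2⟩ := h
  have hp' := hp.extend le_rfl (U := W) fun i j => (mem_past.1 (h1 i j)).2
  refine ⟨U, hU, _, disjointTuples_congr hp'.supp_eq hW, fun i j => ?_, fun i j => ?_⟩
  · convert h1 i j using 1
    abel
  · have h3 := hp'.norm_sub_le i j
    rw [norm_sub_rev] at h3
    calc _ ≤ _ := norm_sub_le_norm_sub_add_norm_sub _ (W i j) _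
      _ ≤ η * Δ j + b * Δ j := add_le_add h3 (h2 i j)
      _ = _ := by ring

theorem Viable.mono (hΔ : ∀ n, 0 < Δ n) (h : Viable e Δ f b S s σ N) (hb : b ≤ b')
    (hS : past e S' N ≤ S) : Viable e Δ f b' S' s σ N := fun T hT hR =>
  (h _ ((past_mono e hT le_rfl).trans hS) (hR.past N)).mono hΔ hb
    ((past_le e _ N).trans (past_le e T N))

theorem Viable.mono_right (h : Viable e Δ f b S s σ N) (N' : ℕ) :
    Viable e Δ f b S s σ N' := fun T hT hR => by
  obtain ⟨U, hU, W, hW, h1, h2⟩ := h _ ((past_le e T N').trans hT) (hR.past N')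
  exact ⟨U, hU, W, hW, fun i j => past_le e _ N (h1 i j), h2⟩

theorem Viable.perturb (h : Viable e Δ f b S s σ N) (hp : Perturb e Δ η N s q) :
    Viable e Δ f (b + η) S q σ N := fun T hT hR => (h T hT hR).perturb hp

theorem Reaches.mono (hΔ : ∀ n, 0 < Δ n) (h : Reaches e Δ f b S s σ N) (hb : b ≤ b')
    (hS : past e S' N ≤ S) : Reaches e Δ f b' S' s σ N := by
  intro V hV
  obtain ⟨s', m, M, hM, h1, h2, h3, h4⟩ := h (fun i => past e (V i) N) fun i =>
    ⟨(past_mono e (hV i).1 le_rfl).trans hS, (hV i).2.past N⟩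
  exact ⟨s', m, M, hM, fun i j => past_le e _ N (h1 i j), h2, h3,
    h4.mono hΔ hb ((past_mono e le_rfl hM).trans hS)⟩

theorem Reaches.mono_right (h : Reaches e Δ f b S s σ N') (hN : N ≤ N') :
    Reaches e Δ f b S s σ N := by
  intro V hV
  obtain ⟨s', m, M, hM, h1, h2⟩ := h V hV
  exact ⟨s', m, M, hN.trans hM, fun i j => past_mono e le_rfl hN (h1 i j), h2⟩

theorem Reaches.perturb (h : Reaches e Δ f b S s σ N) (hp : Perturb e Δ η N s q) :
    Reaches e Δ f (b + η) S q σ N := by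
  intro V hV
  obtain ⟨s', m, M, hM, h1, h2, h3, h4⟩ := h V hV
  have hp' := hp.extend hM (U := s') fun i j => (mem_past.1 (h1 i j)).2
  refine ⟨_, m, M, hM, fun i j => ?_, fun i j => hp'.supp_eq i j ▸ h2 i j, fun i => ?_,
    h4.perturb hp'⟩
  · convert h1 i j using 1
    abel
  · obtain ⟨n, hn⟩ := supp_nonempty e (h3 i)
    exact ne_zero_of_mem_supp (hp'.supp_eq i _ ▸ hn)

/-- If every rich subspace of `S` contains a vector by which one component of `s` can be extended
to a position from which a goal is reached, then the goal is reached from `s`. -/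
theorem Reaches.of_forall_exists {Y : Submodule ℝ X} (hΔ : ∀ n, 0 < Δ n) (hS : S ≤ Y) (i : Fin k)
    (h : ∀ T ≤ S, Rich e T → ∃ j, ∃ x ∈ past e T N,
      Reaches e Δ f b Y (s + site i j x) σ N) :
    Reaches e Δ f b S s σ N := by
  intro V hV
  -- Only component `i` moves, so the single subspace to search is `V i`; this is what allows the `V
  -- i` to be unrelated.
  obtain ⟨j, x, hx, hr⟩ := h (V i) (hV i).1 (hV i).2
  obtain ⟨s', m, M, hM, h1, h2, h3, h4⟩ := hr V fun i' => ⟨(hV i').1.trans hS, (hV i').2⟩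
  refine ⟨s', m, M, hM, fun i' j' => ?_, h2, h3, h4.mono hΔ le_rfl ((past_le e _ _).trans hS)⟩
  have : s' i' j' - s i' j' = (s' i' j' - (s + site i j x) i' j') +
      site i j x i' j' := by
    simp only [Pi.add_apply]
    abel
  rw [this]
  refine Submodule.add_mem _ (h1 i' j') ?_
  exact site_mem fun hi _ => hi ▸ hx

end

section

/-! ### Subspaces deciding all positions -/

/-- For all positions `q` in the finite set `Q N` and all words `σ` of index at most `N`, the
questions whether `q` is viable, and whether a prolongation of `σ` is reached from `q`, have the
same answer in `S` and in all rich subspaces of `S`. -/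
def Decides (e : SchauderBasis ℝ X) (Δ : ℕ → ℝ) {k : ℕ} (f : (ℕ → ℕ) → Fin k → ℕ → X)
    (b₁ : List ℕ → ℝ) (b₂ : List ℕ → ℕ → ℝ) (Q : ℕ → Set (Fin k → ℕ → X)) (N : ℕ)
    (S : Submodule ℝ X) : Prop :=
  ∀ σ : List ℕ, Encodable.encode σ ≤ N → σ.length ≤ N → ∀ q ∈ Q N,
    (Meets e Δ f (b₁ σ) S q σ N → Viable e Δ f (b₁ σ) S q σ N) ∧
    ∀ S' ≤ S, Rich e S' → Reaches e Δ f (b₂ σ N) S' q σ N → Reaches e Δ f (b₂ σ N) S q σ N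

variable {e : SchauderBasis ℝ X} {Δ : ℕ → ℝ} {k : ℕ} {f : (ℕ → ℕ) → Fin k → ℕ → X}
  {b₁ : List ℕ → ℝ} {b₂ : List ℕ → ℕ → ℝ} {Q : ℕ → Set (Fin k → ℕ → X)}

theorem meets_imp_viable_mono (hΔ : ∀ n, 0 < Δ n) {b : ℝ} {S S' : Submodule ℝ X} {N : ℕ}
    {q : Fin k → ℕ → X} {σ : List ℕ} (hS : past e S' N ≤ S)
    (h : Meets e Δ f b S q σ N → Viable e Δ f b S q σ N) :
    Meets e Δ f b S' q σ N → Viable e Δ f b S' q σ N := fun hm =>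
  (h (hm.mono hΔ le_rfl hS)).mono hΔ le_rfl hS

theorem reaches_imp_reaches_mono (hΔ : ∀ n, 0 < Δ n) {b : ℝ} {S S' : Submodule ℝ X} {N : ℕ}
    {q : Fin k → ℕ → X} {σ : List ℕ} (hS : past e S' N ≤ S)
    (h : ∀ T ≤ S, Rich e T → Reaches e Δ f b T q σ N → Reaches e Δ f b S q σ N) :
    ∀ T ≤ S', Rich e T → Reaches e Δ f b T q σ N → Reaches e Δ f b S' q σ N :=
  fun T hT hR hr => (h (past e T N) ((past_mono e hT le_rfl).trans hS) (hR.past N)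
    (hr.mono hΔ le_rfl ((past_le e _ _).trans (past_le e _ _)))).mono hΔ le_rfl hS

theorem exists_decides (hΔ : ∀ n, 0 < Δ n) (hQ : ∀ N, (Q N).Finite) {S₀ : Submodule ℝ X}
    (hS₀ : Rich e S₀) :
    ∃ (a : ℕ → ℕ) (z : ℕ → X), Carried e a z ∧ Submodule.span ℝ (Set.range z) ≤ S₀ ∧
      ∀ n, Decides e Δ f b₁ b₂ Q (a n) (Submodule.span ℝ (Set.range z)) := by
  have hmono : ∀ N S S', past e S' N ≤ S → Decides e Δ f b₁ b₂ Q N S →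
      Decides e Δ f b₁ b₂ Q N S' := by
    intro N S S' hS h σ h1 h2 q hq
    exact ⟨meets_imp_viable_mono hΔ hS (h σ h1 h2 q hq).1,
      reaches_imp_reaches_mono hΔ hS (h σ h1 h2 q hq).2⟩
  have hdense : ∀ N ∈ Set.univ, ∀ S ≤ S₀, Rich e S →
      ∃ S' ≤ S, Rich e S' ∧ Decides e Δ f b₁ b₂ Q N S' := by
    intro N _ S _ hR
    have hfin : ({σ : List ℕ | Encodable.encode σ ≤ N} ×ˢ Q N).Finite := by
      refine Set.Finite.prod ?_ (hQ N)
      exact (Set.finite_Iic N).preimage Encodable.encode_injective.injOn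
    let P : List ℕ × (Fin k → ℕ → X) → Submodule ℝ X → Prop := fun c S =>
      (Meets e Δ f (b₁ c.1) S c.2 c.1 N → Viable e Δ f (b₁ c.1) S c.2 c.1 N) ∧
      ∀ S' ≤ S, Rich e S' → Reaches e Δ f (b₂ c.1 N) S' c.2 c.1 N →
        Reaches e Δ f (b₂ c.1 N) S c.2 c.1 N
    have hmono : ∀ c S S', S' ≤ S → P c S → P c S' := fun c S S' hS h =>
      ⟨meets_imp_viable_mono hΔ ((past_le e _ _).trans hS) h.1,
        reaches_imp_reaches_mono hΔ ((past_le e _ _).trans hS) h.2⟩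
    have hdense : ∀ c, ∀ S₁ ≤ S, Rich e S₁ → ∃ S' ≤ S₁, Rich e S' ∧ P c S' := by
      rintro ⟨σ, q⟩ S₁ - hR₁
      obtain ⟨S₂, h₂, hR₂, hm⟩ : ∃ S₂ ≤ S₁, Rich e S₂ ∧
          (Meets e Δ f (b₁ σ) S₂ q σ N → Viable e Δ f (b₁ σ) S₂ q σ N) := by
        -- If viability fails, a subspace in which `q` is not met makes the implication vacuous.
        by_cases hv : Viable e Δ f (b₁ σ) S₁ q σ N
        · exact ⟨S₁, le_rfl, hR₁, fun _ => hv⟩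
        · unfold Viable at hv
          push Not at hv
          obtain ⟨S₂, h₂, hR₂, hm⟩ := hv
          exact ⟨S₂, h₂, hR₂, fun h => absurd h hm⟩
      by_cases hr : ∃ S₃ ≤ S₂, Rich e S₃ ∧ Reaches e Δ f (b₂ σ N) S₃ q σ N
      · obtain ⟨S₃, h₃, hR₃, hr⟩ := hr
        exact ⟨S₃, h₃.trans h₂, hR₃,
          meets_imp_viable_mono hΔ ((past_le e _ _).trans h₃) hm, fun _ _ _ _ => hr⟩
      · exact ⟨S₂, h₂, hR₂, hm, fun T hT hRT h => absurd ⟨T, hT, hRT, h⟩ hr⟩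
    obtain ⟨S', hS', hR', h⟩ := exists_forall_of_finite e P hmono hR hdense hfin
    exact ⟨S', hS', hR', fun σ h1 _ q hq => h (σ, q) ⟨h1, hq⟩⟩
  obtain ⟨a, z, hc, -, -, hS, hD⟩ := exists_fusion e (Decides e Δ f b₁ b₂ Q) hmono hS₀
    (fun n => ⟨n + 1, Set.mem_univ _, n.lt_succ_self⟩) (Set.mem_univ 0) hdense
  exact ⟨a, z, hc, hS, hD⟩

/-! ### Error bounds -/

/-- The error allowed for a position whose word has length `r`. -/
noncomputable def posError (r : ℕ) : ℝ := 1 - (1 / 2) ^ r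

/-- The error used to decide viability. -/
noncomputable def viableError (σ : List ℕ) : ℝ := 1 - 7 / 4 * (1 / 2) ^ σ.length

/-- The error used at the coordinate `N` for targets of positions whose word has length `r`. -/
noncomputable def targetError (r N : ℕ) : ℝ :=
  1 - 3 / 4 * (1 / 2) ^ r + 1 / 4 * (1 / 2) ^ r * (1 / 2) ^ N

/-- The fineness of the net used at the coordinate `N`. -/
noncomputable def netError (N : ℕ) : ℝ := 1 / 16 * (1 / 4) ^ N

/-- The error used to decide which targets are reached. -/
noncomputable def reachError (σ : List ℕ) (N : ℕ) : ℝ :=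
  targetError σ.length (N + 1) + netError N

theorem netError_pos (N : ℕ) : 0 < netError N := by
  unfold netError
  positivity

theorem posError_le_one (r : ℕ) : posError r ≤ 1 := by
  unfold posError
  linarith [show (0 : ℝ) < (1 / 2) ^ r by positivity]

theorem netError_le {r N : ℕ} (h : r ≤ N) : netError N ≤ 1 / 16 * (1 / 2) ^ r * (1 / 2) ^ N := by
  have h1 : (1 / 4 : ℝ) ^ N = (1 / 2) ^ N * (1 / 2) ^ N := by
    rw [← mul_pow]
    norm_num
  have h2 : (1 / 2 : ℝ) ^ N ≤ (1 / 2) ^ r := pow_le_pow_of_le_one (by norm_num) (by norm_num) h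
  rw [netError, h1, ← mul_assoc]
  gcongr

theorem netError_le' {r N : ℕ} (h : r ≤ N) : netError N ≤ 1 / 16 * (1 / 2) ^ r := by
  refine (netError_le h).trans ?_
  have h1 : (1 / 2 : ℝ) ^ N ≤ 1 := pow_le_one₀ (by norm_num) (by norm_num)
  exact mul_le_of_le_one_right (by positivity) h1

theorem targetError_antitone (r : ℕ) : Antitone (targetError r) := fun N M h => by
  have h2 : (1 / 2 : ℝ) ^ M ≤ (1 / 2) ^ N := pow_le_pow_of_le_one (by norm_num) (by norm_num) h
  unfold targetError
  gcongr

theorem targetError_le (r N : ℕ) : targetError r N ≤ posError (r + 1) := by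
  refine (targetError_antitone r N.zero_le).trans (le_of_eq ?_)
  rw [targetError, posError, pow_succ]
  ring

/-- With `r = σ.length`, the levels increase: `posError r`, `viableError (σ ++ [m])`, `targetError r
N`, `posError (r + 1)`. Non-reachability is propagated along coordinates `N`, with one passage to
the net and one back at each step; the decrease of `targetError r` from `N` to `N + 1` pays for
both. -/
theorem reachError_add_le {σ : List ℕ} {N : ℕ} (h : σ.length ≤ N) :
    reachError σ N + netError N ≤ targetError σ.length N := by
  have := netError_le h
  rw [reachError, targetError, targetError, pow_succ]
  linarith

theorem targetError_add_le {σ : List ℕ} {N M : ℕ} (h : N < M) :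
    targetError σ.length M + netError N ≤ reachError σ N := by
  unfold reachError
  gcongr
  exact targetError_antitone _ h

theorem posError_add_le {σ : List ℕ} {m N : ℕ} (h : σ.length ≤ N) :
    posError σ.length + netError N ≤ viableError (σ ++ [m]) := by
  have := netError_le' h
  have h0 : (0 : ℝ) < (1 / 2) ^ σ.length := by positivity
  rw [posError, viableError, List.length_append, List.length_singleton, pow_succ]
  linarith

theorem viableError_add_le {σ : List ℕ} {m N M : ℕ} (h : σ.length ≤ N) :
    viableError (σ ++ [m]) + netError N ≤ targetError σ.length M := by
  have := netError_le' h
  have h0 : (0 : ℝ) < (1 / 2) ^ σ.length := by positivity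
  have h1 : (0 : ℝ) < 1 / 4 * (1 / 2) ^ σ.length * (1 / 2) ^ M := by positivity
  rw [targetError, viableError, List.length_append, List.length_singleton, pow_succ]
  linarith

/-! ### Viable positions reach viable positions -/

/-- The successive truncations of a disjointly supported extension of `s₀` differ at one place. -/
theorem exists_site_of_truncations {a : ℕ → ℕ} {z : ℕ → X} (hc : Carried e a z) (hk : 0 < k)
    {s₀ W : Fin k → ℕ → X} (hs₀ : ∀ i j, supp e (s₀ i j) ⊆ Set.Iio (a 0))
    (hW : W ∈ disjointTuples e k)
    (hext : ∀ i j, W i j - s₀ i j ∈ Submodule.span ℝ (Set.range z)) (n : ℕ) :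
    ∃ i j, ∃ x ∈ past e (Submodule.span ℝ (Set.range z)) (a n),
      (fun i j => e.proj (a (n + 1)) (W i j)) = (fun i j => e.proj (a n) (W i j)) + site i j x := by
  have hproj : ∀ n i j, e.proj (a n) (s₀ i j) = s₀ i j := fun n i j =>
    proj_eq_self e ((hs₀ i j).trans (Set.Iio_subset_Iio (hc.strictMono.monotone n.zero_le)))
  have hd : ∀ i j, ∃ c : ℝ, e.proj (a (n + 1)) (W i j) - e.proj (a n) (W i j) = c • z n := by
    intro i j
    obtain ⟨c, h⟩ := hc.proj_succ_sub n (hext i j)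
    refine ⟨c, ?_⟩
    rw [← h, map_sub, map_sub, hproj, hproj]
    abel
  choose c hd using hd
  obtain ⟨l, hl⟩ := supp_nonempty e (hc.ne_zero n)
  -- Every term that really uses `z n` has `l` in its support, and by disjointness at most one term
  -- can.
  have hlW : ∀ i j, c i j ≠ 0 → l ∈ supp e (W i j) := by
    intro i j hcij
    have h1 := congrArg (e.coord l) (hd i j)
    have h2 := hc.supp_subset n hl
    rw [map_sub, coord_proj, coord_proj, if_pos h2.2, if_neg (not_lt.2 h2.1), sub_zero,
      map_smul, smul_eq_mul] at h1
    rw [mem_supp, h1]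
    exact mul_ne_zero hcij hl
  by_cases hex : ∃ i j, c i j ≠ 0
  · obtain ⟨i, j, hij⟩ := hex
    refine ⟨i, j, c i j • z n, Submodule.smul_mem _ _ (hc.mem_past n), ?_⟩
    funext i' j'
    rw [Pi.add_apply, Pi.add_apply, ← sub_eq_iff_eq_add', hd i' j']
    by_cases h : i' = i ∧ j' = j
    · obtain ⟨rfl, rfl⟩ := h
      simp [site]
    · have h0 : c i' j' = 0 := by
        by_contra h0
        exact h (disjointTuples_unique hW (hlW _ _ h0) (hlW _ _ hij))
      have : site i j (c i j • z n) i' j' ∈ (⊥ : Submodule ℝ X) :=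
        site_mem fun h1 h2 => absurd ⟨h1, h2⟩ h
      rw [h0, zero_smul, (Submodule.mem_bot ℝ).1 this]
  · push Not at hex
    -- No term uses `z n`: the zero vector at an arbitrary site will do.
    refine ⟨⟨0, hk⟩, 0, 0, Submodule.zero_mem _, ?_⟩
    funext i' j'
    rw [Pi.add_apply, Pi.add_apply, ← sub_eq_iff_eq_add', hd i' j', hex, zero_smul]
    simp [site]

/-- A disjoint tuple in one subspace is built up one site at a time, and each one-site step can be
carried out in whichever `V i` is prescribed for its component. Badness of a position is therefore
inherited by all truncations of a tuple in a diagonal subspace, which is absurd for a long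
truncation. -/
theorem Viable.reaches (hk : 0 < k) (hΔ : ∀ n, 0 < Δ n) (hf : ∀ β i j, ‖f β i j‖ ≤ 1)
    (hQ : ∀ N, (Q N).Finite)
    (hnet : ∀ N, ∀ U ∈ disjointTuples e k, (∀ i j, ‖U i j‖ ≤ 1 + Δ j) →
      ∃ q ∈ Q N, Perturb e Δ (netError N) N (fun i j => e.proj N (U i j)) q)
    {Y : Submodule ℝ X} (hY : Rich e Y) {A : Set ℕ} (hA : ∀ n, ∃ m ∈ A, n < m)
    (hD : ∀ N ∈ A, Decides e Δ f viableError reachError Q N Y)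
    {s₀ : Fin k → ℕ → X} {σ : List ℕ} {M₀ : ℕ} (hs₀ : ∀ i j, supp e (s₀ i j) ⊆ Set.Iio M₀)
    (hv : Viable e Δ f (posError σ.length) Y s₀ σ M₀) :
    Reaches e Δ f (posError (σ.length + 1)) Y s₀ σ M₀ := by
  by_contra hnot
  obtain ⟨M₁, hM₁, hlt⟩ := hA (max M₀ (max (Encodable.encode σ) σ.length))
  simp only [max_lt_iff] at hlt
  obtain ⟨hM₀, hσ, hlen⟩ := hlt
  -- No one-site extension by a vector of `S` beyond `N` makes a bad net position good. The
  -- restriction `M₁ ≤ N` brings `σ` within the scope of `Decides`.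
  let P : ℕ → Submodule ℝ X → Prop := fun N S => M₁ ≤ N → ∀ q ∈ Q N,
    ¬ Reaches e Δ f (reachError σ N) Y q σ N → ∀ i j, ∀ x ∈ past e S N,
      ¬ Reaches e Δ f (reachError σ N) Y (q + site i j x) σ N
  have hmono : ∀ N S S', past e S' N ≤ S → P N S → P N S' := by
    intro N S S' hS h hN q hq hr i j x hx
    exact h hN q hq hr i j x (mem_past.2 ⟨hS hx, (mem_past.1 hx).2⟩)
  have hdense : ∀ N ∈ A, ∀ S ≤ Y, Rich e S → ∃ S' ≤ S, Rich e S' ∧ P N S' := by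
    intro N hN S hSY hR
    by_cases hN₁ : M₁ ≤ N
    · let P' : Fin k × (Fin k → ℕ → X) → Submodule ℝ X → Prop := fun c S => c.2 ∈ Q N →
        ¬ Reaches e Δ f (reachError σ N) Y c.2 σ N → ∀ j, ∀ x ∈ past e S N,
          ¬ Reaches e Δ f (reachError σ N) Y (c.2 + site c.1 j x) σ N
      have hmono' : ∀ c S S', S' ≤ S → P' c S → P' c S' := fun c S S' hS h h1 h2 j x hx =>
        h h1 h2 j x (past_mono e hS le_rfl hx)
      have hdense' : ∀ c, ∀ S₁ ≤ S, Rich e S₁ → ∃ S' ≤ S₁, Rich e S' ∧ P' c S' := by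
        rintro ⟨i, q⟩ S₁ hS₁ hR₁
        -- Otherwise every rich subspace of `S₁` contains a vector making `q` good through component
        -- `i`. Then the goal is reached from `q` in `S₁`, hence in `Y` by `Decides`, and `q` was
        -- not bad.
        by_contra hno
        simp only [P'] at hno
        push Not at hno
        obtain ⟨hq, hr, -⟩ := hno S₁ le_rfl hR₁
        refine hr ((hD N hN σ (hσ.le.trans hN₁) (hlen.le.trans hN₁) q hq).2 S₁ (hS₁.trans hSY) hR₁
          (Reaches.of_forall_exists hΔ (hS₁.trans hSY) i fun T hT hRT => ?_))
        obtain ⟨-, -, j, x, hx, h⟩ := hno T hT hRT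
        exact ⟨j, x, hx, h⟩
      obtain ⟨S', hS', hR', h⟩ := exists_forall_of_finite e P' hmono' hR hdense'
        (Set.finite_univ.prod (hQ N))
      exact ⟨S', hS', hR', fun _ q hq hr i => h (i, q) ⟨trivial, hq⟩ hq hr⟩
    · exact ⟨S, le_rfl, hR, fun h => absurd h hN₁⟩
  obtain ⟨a, z, hc, ha₀, haA, hzY, hz⟩ := exists_fusion e P hmono hY hA hM₁ hdense
  have hle : ∀ n, M₁ ≤ a n := fun n => ha₀ ▸ hc.strictMono.monotone n.zero_le
  have hlen' : ∀ n, σ.length ≤ a n := fun n => hlen.le.trans (hle n)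
  -- Starting at `M₁ = a 0` instead of `M₀` makes the truncation of `W` at `a 0` equal to `s₀`, the
  -- base of the induction in `hcut`.
  obtain ⟨U, hU, W, hW, hext, hWU⟩ := hv.mono_right M₁ _ hzY hc.rich_span
  have hWb : ∀ i j, ‖W i j‖ ≤ 1 + Δ j := by
    obtain ⟨β, -, rfl⟩ := hU
    intro i j
    have h1 : posError σ.length * Δ j ≤ Δ j :=
      mul_le_of_le_one_left (hΔ j).le (posError_le_one _)
    have h2 := norm_le_norm_add_norm_sub' (W i j) (f β i j)
    linarith [hf β i j, hWU i j]
  have hs₁ : ∀ i j, supp e (s₀ i j) ⊆ Set.Iio (a 0) := fun i j =>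
    (hs₀ i j).trans (Set.Iio_subset_Iio (ha₀ ▸ hM₀.le))
  have hproj : ∀ n i j, e.proj (a n) (s₀ i j) = s₀ i j := fun n i j =>
    proj_eq_self e ((hs₁ i j).trans (Set.Iio_subset_Iio (hc.strictMono.monotone n.zero_le)))
  have hspan : ∀ i j, W i j - s₀ i j ∈ Submodule.span ℝ (Set.range z) := fun i j =>
    past_le e _ _ (hext i j)
  have hcut : ∀ n, ¬ Reaches e Δ f (targetError σ.length (a n)) Y
      (fun i j => e.proj (a n) (W i j)) σ (a n) := by
    intro n
    induction n with
    | zero =>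
      have : (fun i j => e.proj (a 0) (W i j)) = s₀ := by
        funext i j
        have h := proj_eq_zero e (mem_past.1 (ha₀.symm ▸ hext i j)).2
        rwa [map_sub, hproj, sub_eq_zero] at h
      rw [this]
      intro hr
      exact hnot ((hr.mono hΔ (targetError_le _ _) (past_le e _ _)).mono_right
        (ha₀ ▸ hM₀.le))
    | succ n ih =>
      obtain ⟨q, hq, hp⟩ := hnet (a n) W hW hWb
      have hq' : ¬ Reaches e Δ f (reachError σ (a n)) Y q σ (a n) := fun hr =>
        ih ((hr.perturb hp.symm).mono hΔ (reachError_add_le (hlen' n)) (past_le e _ _))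
      obtain ⟨i, j, x, hx, heq⟩ := exists_site_of_truncations hc hk hs₁ hW hspan n
      intro hr
      rw [heq] at hr
      have hlt := hc.strictMono n.lt_succ_self
      have hr' := (hr.mono_right hlt.le).perturb (hp.add (d := site i j x) fun i' j' l hl => by
        by_contra h0
        have : site i j x i' j' ∈ past e (Submodule.span ℝ (Set.range z)) (a n) :=
          site_mem fun _ _ => hx
        exact h0 ((mem_past.1 this).2 l hl))
      exact hz n (hle n) q hq hq' i j x hx
        (hr'.mono hΔ (targetError_add_le hlt) (past_le e _ _))
  obtain ⟨m, hm⟩ := mem_cylinderImage_append hU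
  have hl : ∀ i, ∃ l, l ∈ supp e (W i σ.length) := fun i =>
    supp_nonempty e ((hW.1 i).1 _).1
  choose l hl using hl
  -- Large enough for `Decides` to cover `σ ++ [m]` and for the terms of index `σ.length` to have
  -- nonzero truncations, as `Reaches` demands.
  let n := max (Encodable.encode (σ ++ [m])) (max (σ.length + 1) (Finset.univ.sup l + 1))
  have hn : n ≤ a n := hc.strictMono.le_apply
  have hn1 : Encodable.encode (σ ++ [m]) ≤ a n := (le_max_left _ _).trans hn
  have hn2 : σ.length + 1 ≤ a n := ((le_max_left _ _).trans (le_max_right _ _)).trans hn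
  have hn3 : ∀ i, l i < a n := fun i =>
    ((Finset.le_sup (f := l) (Finset.mem_univ i)).trans_lt (Nat.lt_succ_self _)).trans_le
      (((le_max_right _ _).trans (le_max_right _ _)).trans hn)
  obtain ⟨q, hq, hp⟩ := hnet (a n) W hW hWb
  have hmeet : Meets e Δ f (posError σ.length) Y (fun i j => e.proj (a n) (W i j))
      (σ ++ [m]) (a n) := by
    refine ⟨U, hm, W, hW, fun i j => mem_past.2 ⟨?_, fun l hl => ?_⟩, hWU⟩
    · have : W i j - e.proj (a n) (W i j) =
          (W i j - s₀ i j) - e.proj (a n) (W i j - s₀ i j) := by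
        rw [map_sub, hproj]
        abel
      rw [this]
      exact hzY (Submodule.sub_mem _ (hspan i j) (hc.proj_mem_span n (hspan i j)))
    · rw [map_sub, coord_proj, if_pos hl, sub_self]
  have hvia := ((hD _ (haA n) (σ ++ [m]) hn1 (by simpa using hn2) q hq).1
    ((hmeet.perturb hp).mono hΔ (posError_add_le (hlen' n)) (past_le e _ _))).perturb hp.symm
  -- The truncation is its own target: the zero extension lies in every `V i`.
  refine hcut n fun V hV => ⟨_, m, a n, le_rfl, fun i j => ?_, fun i j => ?_, fun i => ?_,
    hvia.mono hΔ (viableError_add_le (hlen' n)) (past_le e _ _)⟩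
  · rw [sub_self]
    exact Submodule.zero_mem _
  · rw [supp_proj]
    exact Set.inter_subset_right
  · refine ne_zero_of_mem_supp (e := e) (i := l i) ?_
    rw [supp_proj]
    exact ⟨hl i, hn3 i⟩

end

section

/-! ### Limits of positions -/

theorem mem_blockSeqs_basis (e : SchauderBasis ℝ X) : e.basis ∈ blockSeqs e := by
  have hsupp : ∀ n, supp e (e n) = {n} := fun n => by
    ext i
    simp [mem_supp, e.ortho, Pi.single_apply]
  refine ⟨fun n => ⟨ne_zero_of_mem_supp (e := e) (i := n) ?_, ?_⟩, fun n i hi j hj => ?_⟩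
  · rw [hsupp]
    rfl
  · rw [hsupp]
    exact Set.finite_singleton n
  · rw [hsupp] at hi hj
    rw [Set.mem_singleton_iff.1 hi, Set.mem_singleton_iff.1 hj]
    exact n.lt_succ_self

theorem Rich.exists_blockSeq {e : SchauderBasis ℝ X} {S : Submodule ℝ X} (hS : Rich e S) :
    ∃ z ∈ blockSeqs e, Submodule.span ℝ (Set.range z) ≤ S := by
  obtain ⟨a, z, hc, -, -, hz, -⟩ := exists_fusion e (fun _ _ => True) (fun _ _ _ _ h => h) hS
    (fun n => ⟨n + 1, Set.mem_univ _, n.lt_succ_self⟩) (Set.mem_univ 0)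
    (fun _ _ S' _ hR => ⟨S', le_rfl, hR, trivial⟩)
  exact ⟨z, hc.mem_blockSeqs, hz⟩

variable {e : SchauderBasis ℝ X} {Δ : ℕ → ℝ} {k : ℕ} {f : (ℕ → ℕ) → Fin k → ℕ → X}

/-- A sequence of viable positions, each extending the previous one, converges to a tuple of block
sequences which is near to an element of the range of `f`. -/
theorem exists_limit (hΔ : ∀ n, 0 < Δ n) (hf : Continuous f) {Y : Submodule ℝ X}
    {V : Fin k → Submodule ℝ X} {s : ℕ → Fin k → ℕ → X} {m M : ℕ → ℕ} (hM : Monotone M)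
    (hs₀ : s 0 = 0) (hs : ∀ r i j, s (r + 1) i j - s r i j ∈ past e (V i) (M r))
    (hsupp : ∀ r i j, supp e (s r i j) ⊆ Set.Iio (M r)) (hne : ∀ r i, s (r + 1) i r ≠ 0)
    (hmeet : ∀ r, Meets e Δ f (posError r) Y (s r) ((List.range r).map m) (M r)) :
    ∃ W : Fin k → ℕ → X, (∀ i, W i ∈ blockSeqs e) ∧ (∀ i j, W i j ∈ V i) ∧
      ∀ i, IsNear Δ (W i) (f m i) := by
  choose U hU W hW hWs hWU using hmeet
  choose β hβ hβU using hU
  have hsV : ∀ r i j, s r i j ∈ V i := by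
    intro r i j
    induction r with
    | zero =>
      rw [hs₀]
      exact Submodule.zero_mem _
    | succ r ih =>
      rw [← sub_add_cancel (s (r + 1) i j) (s r i j)]
      exact Submodule.add_mem _ (past_le e _ _ (hs r i j)) ih
  have hcoord : ∀ r r', r ≤ r' → ∀ i j, ∀ n < M r,
      e.coord n (s r' i j) = e.coord n (s r i j) := by
    intro r r' hr i j n hn
    induction r', hr using Nat.le_induction with
    | base => rfl
    | succ r' hr ih =>
      rw [← ih, ← sub_eq_zero, ← map_sub]
      exact (mem_past.1 (hs r' i j)).2 n (hn.trans_le (hM hr))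
  have hWcoord : ∀ r r', r ≤ r' → ∀ i j, ∀ n < M r,
      e.coord n (W r' i j) = e.coord n (s r i j) := by
    intro r r' hr i j n hn
    rw [← hcoord r r' hr i j n hn, ← sub_eq_zero, ← map_sub]
    exact (mem_past.1 (hWs r' i j)).2 n (hn.trans_le (hM hr))
  -- At stage `j + 2` the term of index `j + 1` is already nonzero below `M (j + 2)`. In the block
  -- sequence `W r i` the term of index `j` must end before it, so it can no longer grow and equals
  -- `s (j + 2) i j`.
  have hlim : ∀ i j r, j + 2 ≤ r → W r i j = s (j + 2) i j := by
    intro i j r hr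
    obtain ⟨l, hl⟩ := supp_nonempty e (hne (j + 1) i)
    have hlM : l < M (j + 2) := hsupp _ _ _ hl
    have hlW : l ∈ supp e (W r i (j + 1)) := by
      rw [mem_supp, hWcoord _ _ hr i _ l hlM]
      exact hl
    refine eq_of_coord e fun n => ?_
    rcases lt_or_ge n (M (j + 2)) with hn | hn
    · exact hWcoord _ _ hr i j n hn
    · have h1 : e.coord n (s (j + 2) i j) = 0 := by
        by_contra h0
        exact absurd (hsupp (j + 2) i j h0) (not_lt.2 hn)
      rw [h1]
      by_contra h0
      have := ((hW r).1 i).2 j n h0 l hlW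
      omega
  refine ⟨fun i j => s (j + 2) i j, fun i => ⟨fun j => ?_, fun j => ?_⟩, fun i j => hsV _ i j,
    fun i j => ?_⟩
  · change s (j + 2) i j ≠ 0 ∧ (supp e (s (j + 2) i j)).Finite
    rw [← hlim i j (j + 2) le_rfl]
    exact ((hW _).1 i).1 j
  · change ∀ n ∈ supp e (s (j + 2) i j), ∀ n' ∈ supp e (s (j + 1 + 2) i (j + 1)), n < n'
    rw [← hlim i j (j + 3) (by omega), ← hlim i (j + 1) (j + 3) le_rfl]
    exact ((hW _).1 i).2 j
  · have hβm : Tendsto β atTop (𝓝 m) := by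
      rw [tendsto_pi_nhds]
      intro n
      refine tendsto_const_nhds.congr' ?_
      filter_upwards [eventually_gt_atTop n] with r hr
      have h := hβ r
      rw [Set.mem_ofPred_eq, List.length_map, List.length_range, List.map_inj_left] at h
      exact (h n (List.mem_range.2 hr)).symm
    have hfβ : Tendsto (fun r => ‖s (j + 2) i j - f (β r) i j‖) atTop
        (𝓝 ‖s (j + 2) i j - f m i j‖) := by
      have h1 := ((hf.tendsto m).comp hβm)
      have h2 := (tendsto_pi_nhds.1 ((tendsto_pi_nhds.1 h1) i)) j
      exact (tendsto_const_nhds.sub h2).norm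
    refine le_of_tendsto hfβ ?_
    filter_upwards [eventually_ge_atTop (j + 2)] with r hr
    rw [← hlim i j r hr, hβU]
    exact (hWU r i j).trans (mul_le_of_le_one_left (hΔ j).le (posError_le_one r))

/-- Each application of `hreach` lengthens the word by one letter and extends the tuple inside the
`V i`; the letters together form the code `α`. -/
theorem exists_near_of_reaches (hΔ : ∀ n, 0 < Δ n) (hf : Continuous f) {Y : Submodule ℝ X}
    (hY : Rich e Y) (h₀ : Viable e Δ f (posError 0) Y 0 [] 0)
    (hreach : ∀ (s : Fin k → ℕ → X) (σ : List ℕ) (M : ℕ), (∀ i j, supp e (s i j) ⊆ Set.Iio M) →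
      Viable e Δ f (posError σ.length) Y s σ M →
      Reaches e Δ f (posError (σ.length + 1)) Y s σ M)
    {V : Fin k → Submodule ℝ X} (hV : ∀ i, V i ≤ Y ∧ Rich e (V i)) :
    ∃ W : Fin k → ℕ → X, (∀ i, W i ∈ blockSeqs e) ∧ (∀ i j, W i j ∈ V i) ∧
      ∃ α, ∀ i, IsNear Δ (W i) (f α i) := by
  let State := {p : (Fin k → ℕ → X) × List ℕ × ℕ // (∀ i j, supp e (p.1 i j) ⊆ Set.Iio p.2.2) ∧
    Viable e Δ f (posError p.2.1.length) Y p.1 p.2.1 p.2.2}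
  have step : ∀ p : State, ∃ (q : State) (m : ℕ), q.1.2.1 = p.1.2.1 ++ [m] ∧ p.1.2.2 ≤ q.1.2.2 ∧
      (∀ i j, q.1.1 i j - p.1.1 i j ∈ past e (V i) p.1.2.2) ∧
      ∀ i, q.1.1 i p.1.2.1.length ≠ 0 := by
    rintro ⟨⟨s, σ, M⟩, hs, hv⟩
    obtain ⟨s', m, M', hM, h1, h2, h3, h4⟩ := hreach s σ M hs hv V hV
    refine ⟨⟨⟨s', σ ++ [m], M'⟩, h2, ?_⟩, m, rfl, hM, h1, h3⟩
    rwa [List.length_append, List.length_singleton]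
  choose g d hd hgM hgs hgne using step
  let p₀ : State := ⟨⟨0, [], 0⟩, by simp [supp], h₀⟩
  let p : ℕ → State := fun n => g^[n] p₀
  have hp : ∀ n, p (n + 1) = g (p n) := fun n => Function.iterate_succ_apply' g n _
  have hσ : ∀ r, (p r).1.2.1 = (List.range r).map fun r => d (p r) := by
    intro r
    induction r with
    | zero => rfl
    | succ r ih => rw [hp, hd, ih, List.range_succ, List.map_append, List.map_singleton]
  have hlen : ∀ r, (p r).1.2.1.length = r := fun r => by
    rw [hσ, List.length_map, List.length_range]
  obtain ⟨W, h1, h2, h3⟩ := exists_limit (e := e) (Y := Y) (V := V) hΔ hf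
    (s := fun r => (p r).1.1) (m := fun r => d (p r)) (M := fun r => (p r).1.2.2)
    (monotone_nat_of_le_succ fun r => by rw [hp]; exact hgM _) rfl
    (fun r i j => by rw [hp]; exact hgs _ i j) (fun r => (p r).2.1)
    (fun r i => by
      have := hgne (p r) i
      rwa [hlen, ← hp] at this)
    (fun r => by
      have := (p r).2.2 Y le_rfl hY
      rwa [hlen, hσ] at this)
  exact ⟨W, h1, h2, _, h3⟩

end

end BlockRamsey

/-! ### The dichotomy -/

theorem theorem2 {X : Type*} [NormedAddCommGroup X] [NormedSpace ℝ X]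
    (e : SchauderBasis ℝ X) (k : ℕ) (hk : 2 ≤ k)
    (F : Set (Fin k → ℕ → X))
    (hFblock : ∀ U ∈ F, ∀ i, U i ∈ BlockRamsey.unitBlockSeqs e)
    (hFanalytic : MeasureTheory.AnalyticSet F)
    (Δ : ℕ → ℝ) (hΔ : ∀ n, 0 < Δ n) :
    ∃ Y ∈ BlockRamsey.blockSeqs e,
      BlockRamsey.disjointUnitTuples e k Y ∩ F = ∅ ∨
        BlockRamsey.unitTuples e k Y ⊆
          BlockRamsey.upClosure e (BlockRamsey.expansion e Δ F) := by
  open BlockRamsey in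
  rw [MeasureTheory.AnalyticSet] at hFanalytic
  rcases hFanalytic with rfl | ⟨f, hf, rfl⟩
  · exact ⟨e.basis, mem_blockSeqs_basis e, Or.inl (Set.inter_empty _)⟩
  -- With error `0` a witness `W` is itself a member of the family, so failure in `S` excludes all
  -- disjoint tuples from `S`; otherwise the empty position is viable, as `posError 0 = 0`.
  by_cases hex : ∃ S, Rich e S ∧ ¬ Meets e Δ f 0 S 0 [] 0
  · obtain ⟨S, hS, hnot⟩ := hex
    obtain ⟨Y, hY, hYS⟩ := hS.exists_blockSeq
    refine ⟨Y, hY, Or.inl (Set.eq_empty_iff_forall_notMem.2 ?_)⟩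
    rintro U ⟨hU, β, rfl⟩
    refine hnot ⟨f β, ⟨β, rfl, rfl⟩, f β, ⟨fun i => (hU.1 i).1.1, hU.2⟩, fun i j => ?_,
      fun i j => by simp⟩
    refine mem_past.2 ⟨?_, fun _ h => absurd h (Nat.not_lt_zero _)⟩
    simpa using hYS ((hU.1 i).2.2.2 j)
  push Not at hex
  choose Q hQ hnet using fun N => exists_finite_net e hΔ k N (netError_pos N)
  obtain ⟨a, Y, hc, -, hD⟩ := exists_decides (f := f) (b₁ := viableError) (b₂ := reachError) hΔ hQ
    (rich_span_of_mem_blockSeqs (mem_blockSeqs_basis e))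
  refine ⟨Y, hc.mem_blockSeqs, Or.inr fun U hU => ⟨fun i => (hU i).1.1, ?_⟩⟩
  have h₀ : Viable e Δ f (posError 0) (Submodule.span ℝ (Set.range Y)) 0 [] 0 := fun S _ hS => by
    rw [posError, pow_zero, sub_self]
    exact hex S hS
  obtain ⟨W, hW, hWU, α, hα⟩ := exists_near_of_reaches hΔ hf hc.rich_span h₀
    (fun s σ M hs hv => hv.reaches (by omega) hΔ (fun β i => (hFblock _ ⟨β, rfl⟩ i).2) hQ hnet
      hc.rich_span (A := Set.range a)
      (fun n => ⟨_, ⟨n + 1, rfl⟩, n.lt_succ_self.trans_le hc.strictMono.le_apply⟩)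
      (by rintro _ ⟨n, rfl⟩; exact hD n) hs)
    (V := fun i => Submodule.span ℝ (Set.range (U i))) (fun i =>
      ⟨Submodule.span_le.2 (Set.range_subset_iff.2 (hU i).2.2.2),
        rich_span_of_mem_blockSeqs (hU i).1.1⟩)
  exact ⟨W, ⟨hW, f α, ⟨α, rfl⟩, hα⟩, fun i => ⟨hW i, (hU i).1.1, hWU i⟩⟩
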